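/- Consider the following incremental cycle detection algorithm on a fixed set of $n$ vertices. It keeps for each vertex $v$ a level $k(v)$, initially $1$; for each integer $i \ge 0$ a bound $b_i(v)$ and a count $c_i(v)$, initially $0$; and a heap $\mathrm{out}(v)$ of outgoing arcs with priorities, initially empty. To insert an arc $(v,w)$, let $A=\{(v,w)\}$ and repeat the following traversal step until a cycle is reported or $A$ is empty. Traversal step: delete an arbitrary arc $(x,y)$ from $A$. If $y=v$, stop the algorithm and report a cycle. Otherwise, if $k(x)\ge k(y)$, set $k(y)\gets k(x)+1$; if $k(x)<k(y)$, let $i=\lfloor \log_2 (k(y)-k(x))\rfloor$, increase $c_i(y)$ by $1$, and if now $c_i(y)=3\cdot 2^{i+1}$, set $c_i(y)\gets 0$, then $k(y)\gets\max\{k(y),\,b_i(y)+3\cdot 2^i\}$, then $b_i(y)\gets k(y)-2^{i+1}$. Finally, delete from $\mathrm{out}(y)$ all arcs with priority at most $k(y)$ and add them to $A$, and add $(x,y)$ to $\mathrm{out}(x)$ with priority $k(y)$. Theorem. There are constants $a,b,c>0$ and $N$ such that for every $n\ge N$ there is a sequence of $m$ pairwise distinct arcs without loops on $n$ vertices, with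 $a n^2\le m\le b n^2$, such that the algorithm, inserting these arcs in order into the initially empty graph, can run to completion, and every execution that stops, whichever arcs are chosen from $A$, performs all $m$ insertions without reporting a cycle and does at least $c\, n^2\log n$ arc traversals (traversal steps) in total. -/

import Mathlib

/-! One-way-search incremental cycle detection for dense graphs.  Arcs `(v, w)` are pairs
`(v, w) : V × V`.  The algorithm is nondeterministic: "delete some arc from `A`" may pick any arc
of `A`. -/

namespace DenseAlgorithm

/-- The data kept by the algorithm.
* `level v` is `k(v)`.
* `bound v i` and `count v i` are `b_i(v)` and `c_i(v)`.  They are stored for every `i : ℕ`; on an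
  `n`-vertex graph that stays acyclic only the entries with `i ≤ ⌊lg n⌋` are ever accessed.
* `out v` is the heap of outgoing arcs of `v`: `(w, p) ∈ out v` means that the arc `(v, w)` is in
  the heap with priority `p`.
* `toDo` is the set `A` of arcs to be traversed. -/
structure State (V : Type*) where
  level : V → ℕ
  bound : V → ℕ → ℕ
  count : V → ℕ → ℕ
  out : V → Finset (V × ℕ)
  toDo : Finset (V × V)

/-- All levels are `1`, all bounds and counts are `0`, all heaps are empty, `A` is empty. -/
def State.init (V : Type*) : State V where
  level _ := 1
  bound _ _ := 0
  count _ _ := 0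
  out _ := ∅
  toDo := ∅

variable {V : Type*} [DecidableEq V]

/-- The part of a traversal step of the arc `(x, y)` that updates the level, bounds and counts of
`y`.  The subtraction `k - 2 ^ (i + 1)` never truncates, since `k ≥ 3 * 2 ^ i`. -/
def State.relabel (s : State V) (x y : V) : State V :=
  if s.level y ≤ s.level x then
    { s with level := Function.update s.level y (s.level x + 1) }
  else
    let i := Nat.log 2 (s.level y - s.level x)
    if s.count y i + 1 = 3 * 2 ^ (i + 1) then
      let k := max (s.level y) (s.bound y i + 3 * 2 ^ i)
      { s with
        count := Function.update s.count y (Function.update (s.count y) i 0)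
        level := Function.update s.level y k
        bound := Function.update s.bound y (Function.update (s.bound y) i (k - 2 ^ (i + 1))) }
    else
      { s with
        count := Function.update s.count y
          (Function.update (s.count y) i (s.count y i + 1)) }

/-- Delete from `out(y)` every arc with priority at most `k(y)` and add these arcs to `A`. -/
def State.release (s : State V) (y : V) : State V :=
  { s with
    out := Function.update s.out y {e ∈ s.out y | s.level y < e.2}
    toDo := s.toDo ∪ ({e ∈ s.out y | e.2 ≤ s.level y}).image (fun e => (y, e.1)) }

/-- Add the arc `(x, y)` to `out(x)` with priority `k(y)`. -/
def State.enqueue (s : State V) (x y : V) : State V :=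
  { s with out := Function.update s.out x (insert (y, s.level y) (s.out x)) }

/-- The traversal step of an arc `(x, y)` of `A`, when it does not report a cycle. -/
def State.traverse (s : State V) (x y : V) : State V :=
  ((({ s with toDo := s.toDo.erase (x, y) } : State V).relabel x y).release y).enqueue x y

/-- A configuration of the algorithm while it handles a sequence of arc insertions. -/
structure Config (V : Type*) where
  /-- the data kept by the algorithm -/
  state : State V
  /-- the arcs whose insertion has not started yet -/
  pending : List (V × V)
  /-- the vertex `v` of the latest arc `(v, w)` to be inserted, if there is one -/
  source : Option V
  /-- whether a cycle has been reported -/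
  cycle : Bool
  /-- the number of arc traversals done so far -/
  traversals : ℕ

/-- The configuration before the first insertion. -/
def Config.init (arcs : List (V × V)) : Config V where
  state := State.init V
  pending := arcs
  source := none
  cycle := false
  traversals := 0

/-- One step of the algorithm.  Nothing happens after a cycle has been reported. -/
inductive Step : Config V → Config V → Prop
  /-- When `A` is empty, start to insert the next arc. -/
  | insert (c : Config V) (v w : V) (rest : List (V × V)) (hc : c.cycle = false)
      (hA : c.state.toDo = ∅) (hp : c.pending = (v, w) :: rest) :
      Step c { c with
        state := { c.state with toDo := {(v, w)} }
        pending := rest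
        source := some v }
  /-- A traversal step for some arc `(x, y)` of `A` with `y = v`: report a cycle. -/
  | report (c : Config V) (x y : V) (hc : c.cycle = false)
      (hA : (x, y) ∈ c.state.toDo) (hy : c.source = some y) :
      Step c { c with
        state := { c.state with toDo := c.state.toDo.erase (x, y) }
        cycle := true
        traversals := c.traversals + 1 }
  /-- A traversal step for some arc `(x, y)` of `A` with `y ≠ v`. -/
  | traverse (c : Config V) (x y : V) (hc : c.cycle = false)
      (hA : (x, y) ∈ c.state.toDo) (hy : c.source ≠ some y) :
      Step c { c with
        state := c.state.traverse x y
        traversals := c.traversals + 1 }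

/-- The algorithm has reported a cycle, or it has completed all the insertions. -/
def Config.Halted (c : Config V) : Prop :=
  c.cycle = true ∨ (c.state.toDo = ∅ ∧ c.pending = [])

/-- Some execution of the algorithm on the sequence of insertions `arcs` gets to `c` and stops
there. -/
def IsOutcome (arcs : List (V × V)) (c : Config V) : Prop :=
  Relation.ReflTransGen Step (Config.init arcs) c ∧ c.Halted

end DenseAlgorithm

/-! The instance has a path `p 0, …, p T` with `T = 2 ^ L` and `n / 8 < 2 ^ L ≤ n / 4`, a set `Y` of
`2 ^ L` sinks, and for each `i ≤ L` a group `X i` of `2 ^ i` vertices with arcs to all of `Y`. The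
path is a ladder: `p j` settles at level `j + 1`, so an arc from it lifts a lower head to exactly `j
+ 2`. The sinks climb one level per block. The vertices of `X i` climb in jumps of `2 ^ (i + 1)`,
timed so that `k(y) - k(x) = 2 ^ i` whenever their arcs are traversed. Those arcs have priority `2 ^
i` above the old level of `x`, so each jump releases all of them.

Block `t` serves the scale `i = padicValNat 2 (t + 1)` and costs `2 ^ i * |Y|` traversals. Scale `i`
is served about `T / 2 ^ (i + 1)` times, so each of the roughly `log T` scales contributes about `T
* |Y| / 2`, which gives order `n ^ 2 * log n`.

The danger is that the counts lift the sinks prematurely. A round at scale `i` adds at most `2 ^ i`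
to `c_i(y)`, while `k(y)` gains `2 ^ (i + 1)` between rounds; scales do not interact. Hence `b_i(y)
+ c_i(y)` stays low enough that the level proposed on a full count never exceeds `k(y)`
(`State.traverse_count`). As sinks release nothing, the order of choices from `A` is irrelevant
(`Sure.traverse_all`). The Hoare-style predicate `Triple` composes single insertions into rounds and
blocks (`Triple.round`, `Triple.block`, `sure_allArcs`). -/

namespace DenseAlgorithm

/-! ### Hoare logic for nondeterministic executions -/

variable {V : Type*} [DecidableEq V]

/-- Some execution from `c` halts, and every execution from `c` that halts reports no cycle and
ends with at least `Z` traversals. -/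
def Sure (c : Config V) (Z : ℕ) : Prop :=
  (∃ o, Relation.ReflTransGen Step c o ∧ o.Halted) ∧
    ∀ o, Relation.ReflTransGen Step c o → o.Halted → o.cycle = false ∧ Z ≤ o.traversals

lemma Sure.of_step {c : Config V} {Z : ℕ} (hc : ¬ c.Halted) (hs : ∃ c', Step c c')
    (h : ∀ c', Step c c' → Sure c' Z) : Sure c Z := by
  refine ⟨?_, fun o ho hh => ?_⟩
  · obtain ⟨c', hc'⟩ := hs
    obtain ⟨o, ho, hh⟩ := (h c' hc').1
    exact ⟨o, .head hc' ho, hh⟩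
  · rcases Relation.ReflTransGen.cases_head ho with rfl | ⟨c', hc', ho'⟩
    · exact absurd hh hc
    · exact (h c' hc').2 o ho' hh

lemma Sure.of_halted {s : State V} {src : Option V} {tr Z : ℕ} (hs : s.toDo = ∅) (hZ : Z ≤ tr) :
    Sure ⟨s, [], src, false, tr⟩ Z := by
  refine ⟨⟨_, .refl, .inr ⟨hs, rfl⟩⟩, fun o ho _ => ?_⟩
  rcases Relation.ReflTransGen.cases_head ho with rfl | ⟨c', hc', -⟩
  · exact ⟨rfl, hZ⟩
  · cases hc' <;> simp_all

lemma Sure.insert {s : State V} {v w : V} {rest : List (V × V)} {src : Option V} {tr Z : ℕ}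
    (hs : s.toDo = ∅)
    (h : Sure ⟨{ s with toDo := {(v, w)} }, rest, some v, false, tr⟩ Z) :
    Sure ⟨s, (v, w) :: rest, src, false, tr⟩ Z := by
  refine .of_step (by simp [Config.Halted]) ⟨_, .insert _ v w rest rfl hs rfl⟩ fun c' hc' => ?_
  cases hc' with
  | insert v' w' rest' hc hA hp =>
    simp only [List.cons.injEq, Prod.mk.injEq] at hp
    obtain ⟨⟨rfl, rfl⟩, rfl⟩ := hp
    exact h
  | report x y hc hA hy => simp [hs] at hA
  | traverse x y hc hA hy => simp [hs] at hA

lemma Sure.traverse {s : State V} {u : V} {rest : List (V × V)} {tr Z : ℕ}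
    (hs : s.toDo.Nonempty)
    (h : ∀ x y, (x, y) ∈ s.toDo →
      u ≠ y ∧ Sure ⟨s.traverse x y, rest, some u, false, tr + 1⟩ Z) :
    Sure ⟨s, rest, some u, false, tr⟩ Z := by
  refine .of_step (by simp [Config.Halted, hs.ne_empty]) ?_ fun c' hc' => ?_
  · obtain ⟨⟨x, y⟩, hxy⟩ := hs
    exact ⟨_, .traverse _ x y rfl hxy (by simpa using (h x y hxy).1)⟩
  · cases hc' with
    | insert v' w' rest' hc hA hp => exact absurd hA hs.ne_empty
    | report x y hc hA hy => exact absurd (by simpa using hy) (h x y hA).1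
    | traverse x y hc hA hy => exact (h x y hA).2

/-- Inserting the arcs `L` in a state that satisfies `A` takes at least `W` traversals, reports no
cycle, and leads to a state that satisfies `B`. -/
def Triple (A : State V → Prop) (L : List (V × V)) (W : ℕ) (B : State V → Prop) : Prop :=
  ∀ s src rest tr Z, s.toDo = ∅ → A s →
    (∀ s' src' tr', s'.toDo = ∅ → B s' → tr + W ≤ tr' → Sure ⟨s', rest, src', false, tr'⟩ Z) →
    Sure ⟨s, L ++ rest, src, false, tr⟩ Z

lemma Triple.nil {A B : State V → Prop} (h : ∀ s, A s → B s) : Triple A [] 0 B :=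
  fun _ _ _ _ _ hs hA hB => hB _ _ _ hs (h _ hA) le_rfl

/-- A triple quantifies over the remaining arcs and over the final bound `Z`, so composing two
triples is composing continuations. -/
lemma Triple.append {A B C : State V → Prop} {L₁ L₂ : List (V × V)} {W₁ W₂ : ℕ}
    (h₁ : Triple A L₁ W₁ B) (h₂ : Triple B L₂ W₂ C) :
    Triple A (L₁ ++ L₂) (W₁ + W₂) C := by
  intro s src rest tr Z hs hA hC
  rw [List.append_assoc]
  refine h₁ _ _ _ _ _ hs hA fun s' src' tr' hs' hB htr => ?_
  exact h₂ _ _ _ _ _ hs' hB fun s'' src'' tr'' hs'' hC' htr' =>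
    hC _ _ _ hs'' hC' (by omega)

lemma Triple.mono {A A' B B' : State V → Prop} {L : List (V × V)} {W W' : ℕ}
    (h : Triple A L W B) (hA : ∀ s, A' s → A s) (hB : ∀ s, B s → B' s) (hW : W' ≤ W) :
    Triple A' L W' B' :=
  fun _ _ _ _ _ hs hA' hC => h _ _ _ _ _ hs (hA _ hA') fun _ _ _ hs' hB' htr =>
    hC _ _ _ hs' (hB _ hB') (by omega)

lemma Triple.range {A : ℕ → State V → Prop} {f : ℕ → List (V × V)} {W : ℕ → ℕ} {n : ℕ}
    (h : ∀ t < n, Triple (A t) (f t) (W t) (A (t + 1))) :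
    Triple (A 0) ((List.range n).flatMap f) (∑ t ∈ Finset.range n, W t) (A n) := by
  induction n with
  | zero => exact Triple.nil fun _ => id
  | succ n ih =>
    rw [List.range_succ, List.flatMap_append, Finset.sum_range_succ]
    simpa using (ih fun t ht => h t (by omega)).append (h n (by omega))

/-- The assertion depends on the set of processed vertices, not on their order, because
`Finset.toList` gives an unspecified order. -/
lemma Triple.list {A : Finset V → State V → Prop} {f : V → List (V × V)} {W : ℕ} (l : List V)
    (D : Finset V) (hl : l.Nodup) (hD : ∀ a ∈ l, a ∉ D)
    (h : ∀ a ∈ l, ∀ E ⊆ D ∪ l.toFinset, a ∉ E → Triple (A E) (f a) W (A (insert a E))) :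
    Triple (A D) (l.flatMap f) (l.length * W) (A (D ∪ l.toFinset)) := by
  induction l generalizing D with
  | nil => simpa using Triple.nil fun _ => id
  | cons a l ih =>
    rw [List.nodup_cons] at hl
    have h₁ := h a (by simp) D Finset.subset_union_left (hD a (by simp))
    have h₂ := ih (insert a D) hl.2
      (fun b hb => by
        have := hD b (by simp [hb])
        have : b ≠ a := by rintro rfl; exact hl.1 hb
        simp [*])
      (fun b hb E hE => h b (by simp [hb]) E (by
        intro z hz; have := hE hz; simp only [Finset.mem_union, Finset.mem_insert,
          List.mem_toFinset, List.mem_cons] at this ⊢; tauto))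
    have h₃ := h₁.append h₂
    have e : insert a D ∪ l.toFinset = D ∪ (a :: l).toFinset := by
      ext z; simp
    rw [e] at h₃
    rw [List.flatMap_cons, List.length_cons, Nat.succ_mul, Nat.add_comm]
    exact h₃

lemma Triple.finset {A : Finset V → State V → Prop} {f : V → List (V × V)} {W : ℕ} (F : Finset V)
    (h : ∀ a ∈ F, ∀ E ⊆ F, a ∉ E → Triple (A E) (f a) W (A (insert a E))) :
    Triple (A ∅) (F.toList.flatMap f) (F.card * W) (A F) := by
  simpa using Triple.list (A := A) (f := f) (W := W) F.toList ∅ F.nodup_toList (by simp)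
    (by simpa using h)

/-! ### Effect of a single traversal -/

/-- The state after a traversal of `(u, w)` that lifts `w` just above `u`. -/
def State.raise (s : State V) (u w : V) : State V where
  level := Function.update s.level w (s.level u + 1)
  bound := s.bound
  count := s.count
  out := Function.update (Function.update s.out w {e ∈ s.out w | s.level u + 1 < e.2}) u
    (insert (w, s.level u + 1)
      ((Function.update s.out w {e ∈ s.out w | s.level u + 1 < e.2}) u))
  toDo := s.toDo.erase (u, w) ∪
    ({e ∈ s.out w | e.2 ≤ s.level u + 1}).image (fun e => (w, e.1))

lemma State.traverse_eq_raise {s : State V} {u w : V} (h : s.level w ≤ s.level u) :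
    s.traverse u w = s.raise u w := by
  simp [State.traverse, State.relabel, State.release, State.enqueue, State.raise, h]

/-- A traversal of `(x, y)` that does not change levels. -/
lemma State.traverse_count {s : State V} {x y : V} {i C : ℕ}
    (h : s.level x + 2 ^ i = s.level y) (hy : s.out y = ∅)
    (hC : s.bound y i + s.count y i ≤ C) (h₁ : C + 1 ≤ s.level y + 3 * 2 ^ i)
    (h₂ : s.level y ≤ C + 1 + 2 ^ (i + 1)) :
    (s.traverse x y).level = s.level ∧
    (s.traverse x y).out = Function.update s.out x (insert (y, s.level y) (s.out x)) ∧
    (s.traverse x y).toDo = s.toDo.erase (x, y) ∧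
    (∀ z j, (z ≠ y ∨ j ≠ i) → (s.traverse x y).bound z j = s.bound z j ∧
      (s.traverse x y).count z j = s.count z j) ∧
    (s.traverse x y).bound y i + (s.traverse x y).count y i ≤ C + 1 := by
  have hpos : 0 < 2 ^ i := by positivity
  have hlt : ¬ s.level y ≤ s.level x := by omega
  have hlog : Nat.log 2 (s.level y - s.level x) = i := by
    rw [← h, Nat.add_sub_cancel_left, Nat.log_pow (by norm_num)]
  have hupd : Function.update s.out y ∅ = s.out := by
    rw [← hy, Function.update_eq_self]
  by_cases hw : s.count y i + 1 = 3 * 2 ^ (i + 1)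
  · have hmax : max (s.level y) (s.bound y i + 3 * 2 ^ i) = s.level y := by
      rw [pow_succ] at hw; omega
    have hlev : Function.update s.level y (s.level y) = s.level := Function.update_eq_self _ _
    simp only [State.traverse, State.relabel, State.release, State.enqueue, hlt, if_false, hlog,
      hw, if_true, hmax, hlev, hy, Finset.filter_empty, hupd, Finset.image_empty,
      Finset.union_empty, true_and]
    refine ⟨fun z j hzj => ?_, ?_⟩
    · by_cases hz : z = y
      · subst hz
        have : j ≠ i := by tauto
        simp [this]
      · simp [hz]
    · simp; omega
  · simp only [State.traverse, State.relabel, State.release, State.enqueue, hlt, if_false, hlog,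
      hw, hy, Finset.filter_empty, hupd, Finset.image_empty,
      Finset.union_empty, true_and]
    refine ⟨fun z j hzj => ?_, ?_⟩
    · by_cases hz : z = y
      · subst hz
        have : j ≠ i := by tauto
        simp [this]
      · simp [hz]
    · simp; omega

/-! ### The hard instance and its invariant -/

/-- The vertices of the hard instance: a path `p 0, …, p T`, groups `X i` of vertices that are
lifted in jumps of `2 ^ (i + 1)`, and a group `Y` of vertices that are lifted in jumps of `1`. -/
structure Layout (V : Type*) (T : ℕ) where
  p : ℕ → V
  X : ℕ → Finset V
  Y : Finset V
  rank : V → ℕ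
  p_inj : ∀ j ≤ T, ∀ j' ≤ T, p j = p j' → j = j'
  p_X : ∀ j ≤ T, ∀ i, p j ∉ X i
  p_Y : ∀ j ≤ T, p j ∉ Y
  X_Y : ∀ i, ∀ x ∈ X i, x ∉ Y
  rank_X : ∀ i, ∀ x ∈ X i, rank x = i
  card_X : ∀ i, (X i).card ≤ 2 ^ i

variable {T : ℕ} (G : Layout V T)

/-- The vertices `p 0, …, p a` have their final levels, the other ones on the path are untouched,
the levels of the other vertices are given by `l`, the heaps of the vertices in the groups `X i` by
`o`, and `C` bounds the sum of bound and count for the vertices of `Y`. -/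
structure Core (a : ℕ) (l : V → ℕ) (o : V → Finset (V × ℕ)) (C : V → ℕ → ℕ) (s : State V) :
    Prop where
  path : ∀ j ≤ a, j ≤ T → s.level (G.p j) = j + 1
  fresh : ∀ j, a < j → j ≤ T → s.level (G.p j) = 1 ∧ s.out (G.p j) = ∅
  levelY : ∀ y ∈ G.Y, s.level y = l y
  outY : ∀ y ∈ G.Y, s.out y = ∅
  countY : ∀ y ∈ G.Y, ∀ i, s.bound y i + s.count y i ≤ C y i
  levelX : ∀ i, ∀ x ∈ G.X i, s.level x = l x
  outX : ∀ i, ∀ x ∈ G.X i, s.out x = o x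

variable {G} {a : ℕ} {l : V → ℕ} {o : V → Finset (V × ℕ)} {C : V → ℕ → ℕ} {s : State V}

omit [DecidableEq V] in
lemma Core.congr (h : Core G a l o C s) {l' : V → ℕ} {o' : V → Finset (V × ℕ)}
    {C' : V → ℕ → ℕ} (hY : ∀ y ∈ G.Y, l y = l' y) (hC : ∀ y ∈ G.Y, ∀ i, C y i ≤ C' y i)
    (hX : ∀ i, ∀ x ∈ G.X i, l x = l' x ∧ o x = o' x) : Core G a l' o' C' s where
  path := h.path
  fresh := h.fresh
  levelY y hy := (h.levelY y hy).trans (hY y hy)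
  outY := h.outY
  countY y hy i := (h.countY y hy i).trans (hC y hy i)
  levelX i x hx := (h.levelX i x hx).trans (hX i x hx).1
  outX i x hx := (h.outX i x hx).trans (hX i x hx).2

omit [DecidableEq V] in
lemma Core.toDo (h : Core G a l o C s) (A : Finset (V × V)) :
    Core G a l o C { s with toDo := A } :=
  ⟨h.path, h.fresh, h.levelY, h.outY, h.countY, h.levelX, h.outX⟩

lemma Core.raise_Y (h : Core G a l o C s) {j : ℕ} (hj : j ≤ a) (hT : j ≤ T) {y : V}
    (hy : y ∈ G.Y) : Core G a (Function.update l y (j + 2)) o C (s.raise (G.p j) y) := by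
  have hp := h.path j hj hT
  have hpy : ∀ j ≤ T, G.p j ≠ y := fun j hj e => G.p_Y j hj (e ▸ hy)
  have hXy : ∀ i, ∀ x ∈ G.X i, x ≠ y := fun i x hx e => G.X_Y i x hx (e ▸ hy)
  have hXp : ∀ i, ∀ x ∈ G.X i, x ≠ G.p j := fun i x hx e => G.p_X j hT i (e ▸ hx)
  have hYp : ∀ y ∈ G.Y, y ≠ G.p j := fun y hy e => G.p_Y j hT (e ▸ hy)
  refine ⟨fun j' h₁ h₂ => ?_, fun j' h₁ h₂ => ?_, fun z hz => ?_, fun z hz => ?_,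
    fun z hz i => h.countY z hz i, fun i x hx => ?_, fun i x hx => ?_⟩
  · simp [State.raise, hpy j' h₂, h.path j' h₁ h₂]
  · have hne : G.p j' ≠ G.p j := fun e => by have := G.p_inj _ h₂ _ hT e; omega
    simp [State.raise, hpy j' h₂, hne, h.fresh j' h₁ h₂]
  · by_cases hzy : z = y
    · subst hzy; simp [State.raise, hp]
    · simp [State.raise, hzy, h.levelY z hz]
  · by_cases hzy : z = y
    · subst hzy; simp [State.raise, hYp z hz, h.outY z hz]
    · simp [State.raise, hYp z hz, hzy, h.outY z hz]
  · simp [State.raise, hXy i x hx, h.levelX i x hx]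
  · simp [State.raise, hXy i x hx, hXp i x hx, h.outX i x hx]

lemma Core.raise_p (h : Core G a l o C s) (hT : a + 1 ≤ T) :
    Core G (a + 1) l o C (s.raise (G.p a) (G.p (a + 1))) := by
  have hp := h.path a le_rfl (by omega)
  have hpX : ∀ j ≤ T, ∀ i, ∀ x ∈ G.X i, x ≠ G.p j := fun j hT i x hx e => G.p_X j hT i (e ▸ hx)
  have hpY : ∀ j ≤ T, ∀ y ∈ G.Y, y ≠ G.p j := fun j hT y hy e => G.p_Y j hT (e ▸ hy)
  have hpp : ∀ j ≤ T, ∀ j' ≤ T, j ≠ j' → G.p j ≠ G.p j' :=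
    fun j hj j' hj' hne e => hne (G.p_inj j hj j' hj' e)
  refine ⟨fun j' h₁ h₂ => ?_, fun j' h₁ h₂ => ?_, fun z hz => ?_, fun z hz => ?_,
    fun z hz i => h.countY z hz i, fun i x hx => ?_, fun i x hx => ?_⟩
  · by_cases hj : j' = a + 1
    · subst hj; simp [State.raise, hp]
    · simp [State.raise, hpp j' h₂ (a + 1) hT hj, h.path j' (by omega) h₂]
  · simp [State.raise, hpp j' h₂ (a + 1) hT (by omega), hpp j' h₂ a (by omega) (by omega),
      h.fresh j' (by omega) h₂]
  · simp [State.raise, hpY _ hT z hz, h.levelY z hz]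
  · simp [State.raise, hpY _ hT z hz, hpY a (by omega) z hz, h.outY z hz]
  · simp [State.raise, hpX _ hT i x hx, h.levelX i x hx]
  · simp [State.raise, hpX _ hT i x hx, hpX a (by omega) i x hx, h.outX i x hx]

/-- No priority in the heap exceeds the new level, so the lift releases the whole heap. -/
lemma Core.raise_X (h : Core G a l o C s) {j : ℕ} (hj : j ≤ a) (hT : j ≤ T) {i : ℕ} {x : V}
    (hx : x ∈ G.X i) (ho : ∀ e ∈ o x, e.2 ≤ j + 2) :
    Core G a (Function.update l x (j + 2)) (Function.update o x ∅) C (s.raise (G.p j) x) := by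
  have hp := h.path j hj hT
  have hpx : ∀ j ≤ T, G.p j ≠ x := fun j hj e => G.p_X j hj i (e ▸ hx)
  have hXp : ∀ i, ∀ x ∈ G.X i, x ≠ G.p j := fun i x hx e => G.p_X j hT i (e ▸ hx)
  have hYp : ∀ y ∈ G.Y, y ≠ G.p j := fun y hy e => G.p_Y j hT (e ▸ hy)
  have hYx : ∀ y ∈ G.Y, y ≠ x := fun y hy e => G.X_Y i x hx (e ▸ hy)
  refine ⟨fun j' h₁ h₂ => ?_, fun j' h₁ h₂ => ?_, fun z hz => ?_, fun z hz => ?_,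
    fun z hz i => h.countY z hz i, fun i' z hz => ?_, fun i' z hz => ?_⟩
  · simp [State.raise, hpx j' h₂, h.path j' h₁ h₂]
  · have hne : G.p j' ≠ G.p j := fun e => by have := G.p_inj _ h₂ _ hT e; omega
    simp [State.raise, hpx j' h₂, hne, h.fresh j' h₁ h₂]
  · simp [State.raise, hYx z hz, h.levelY z hz]
  · simp [State.raise, hYp z hz, hYx z hz, h.outY z hz]
  · by_cases hzx : z = x
    · subst hzx; simp [State.raise, hp]
    · simp [State.raise, hzx, h.levelX i' z hz]
  · by_cases hzx : z = x
    · subst hzx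
      simp only [State.raise, hXp i' z hz, hp, h.outX i' z hz, Function.update_self, ne_eq,
        not_false_eq_true, Function.update_of_ne]
      exact Finset.filter_eq_empty_iff.2 fun e he => by have := ho e he; omega
    · simp [State.raise, hzx, hXp i' z hz, h.outX i' z hz]

lemma Core.count (h : Core G a l o C s) {i : ℕ} {x y : V} (hx : x ∈ G.X i) (hy : y ∈ G.Y)
    (hxy : l x + 2 ^ i = l y) (h₁ : C y i + 1 ≤ l y + 3 * 2 ^ i)
    (h₂ : l y ≤ C y i + 1 + 2 ^ (i + 1)) :
    Core G a l (Function.update o x (insert (y, l y) (o x)))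
      (fun z j => if z = y ∧ j = i then C y i + 1 else C z j) (s.traverse x y) ∧
    (s.traverse x y).toDo = s.toDo.erase (x, y) := by
  have ly := h.levelY y hy
  have lx := h.levelX i x hx
  have ox := h.outX i x hx
  obtain ⟨e₁, e₂, e₃, e₄, e₅⟩ := State.traverse_count (s := s) (x := x) (y := y) (i := i)
    (C := C y i) (by omega) (h.outY y hy) (h.countY y hy i) (by omega) (by omega)
  have hpx : ∀ j ≤ T, G.p j ≠ x := fun j hj e => G.p_X j hj i (e ▸ hx)
  have hYx : ∀ y ∈ G.Y, y ≠ x := fun y hy e => G.X_Y i x hx (e ▸ hy)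
  refine ⟨⟨?_, fun j hj hT => ?_, ?_, fun z hz => ?_, fun z hz j => ?_, ?_, fun j z hz => ?_⟩, e₃⟩
  · rw [e₁]; exact h.path
  · rw [e₁, e₂, Function.update_of_ne (hpx j hT)]; exact h.fresh j hj hT
  · rw [e₁]; exact h.levelY
  · rw [e₂, Function.update_of_ne (hYx z hz)]; exact h.outY z hz
  · split_ifs with hzj
    · obtain ⟨rfl, rfl⟩ := hzj; exact e₅
    · rw [(e₄ z j (by tauto)).1, (e₄ z j (by tauto)).2]; exact h.countY z hz j
  · rw [e₁]; exact h.levelX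
  · rw [e₂]
    by_cases hzx : z = x
    · subst hzx; simp [ly, ox]
    · simp [hzx, h.outX j z hz]

/-! ### Triples for single insertions and for one vertex of `X i` -/

/-- Insertion of an arc that leads to a single traversal, which lifts the head. -/
lemma Sure.insert_raise {u w : V} {rest : List (V × V)} {src : Option V} {tr Z : ℕ}
    (hs : s.toDo = ∅) (huw : u ≠ w) (hlev : s.level w ≤ s.level u)
    (h : Sure ⟨({ s with toDo := {(u, w)} } : State V).raise u w, rest, some u, false, tr + 1⟩ Z) :
    Sure ⟨s, (u, w) :: rest, src, false, tr⟩ Z := by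
  refine .insert hs (.traverse (by simp) fun x y hxy => ?_)
  simp only [Finset.mem_singleton, Prod.mk.injEq] at hxy
  obtain ⟨rfl, rfl⟩ := hxy
  rw [State.traverse_eq_raise (s := { s with toDo := {(x, y)} }) hlev]
  exact ⟨huw, h⟩

lemma Triple.raise_Y {j : ℕ} (hj : j ≤ a) (hT : j ≤ T) {y : V} (hy : y ∈ G.Y)
    (hl : l y ≤ j + 1) :
    Triple (Core G a l o C) [(G.p j, y)] 0 (Core G a (Function.update l y (j + 2)) o C) := by
  intro s src rest tr Z hs hA hB
  refine .insert_raise hs (fun e => G.p_Y j hT (e ▸ hy))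
    (by rw [hA.levelY y hy, hA.path j hj hT]; exact hl) ?_
  refine hB _ _ _ ?_ ((hA.toDo _).raise_Y hj hT hy) (by omega)
  simp [State.raise, hA.outY y hy]

lemma Triple.raise_p (hT : a + 1 ≤ T) :
    Triple (Core G a l o C) [(G.p a, G.p (a + 1))] 0 (Core G (a + 1) l o C) := by
  intro s src rest tr Z hs hA hB
  have hf := hA.fresh (a + 1) (by omega) hT
  refine .insert_raise hs (fun e => by have := G.p_inj a (by omega) (a + 1) hT e; omega)
    (by rw [hf.1, hA.path a le_rfl (by omega)]; omega) ?_
  refine hB _ _ _ ?_ ((hA.toDo _).raise_p hT) (by omega)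
  simp [State.raise, hf.2]

/-- The conditions under which the traversals of the arcs from `x ∈ X i` to `Y` are harmless. -/
structure Ready (G : Layout V T) (i k : ℕ) (l : V → ℕ) (C : V → ℕ → ℕ) (x : V) : Prop where
  levelY : ∀ y ∈ G.Y, l y = k
  levelx : l x + 2 ^ i = k
  upper : ∀ y ∈ G.Y, C y i + 1 ≤ k + 3 * 2 ^ i
  lower : ∀ y ∈ G.Y, k ≤ C y i + 1 + 2 ^ (i + 1)

/-- The heaps after the arcs from `x` to the vertices in `D` have got the priority `k`. -/
def heapUpd (o : V → Finset (V × ℕ)) (x : V) (k : ℕ) (D : Finset V) : V → Finset (V × ℕ) :=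
  Function.update o x (D.image fun y => (y, k))

/-- The bounds `C` after one more count at scale `i` for the vertices in `D`. -/
def countUpd (C : V → ℕ → ℕ) (i : ℕ) (D : Finset V) : V → ℕ → ℕ :=
  fun y j => C y j + if y ∈ D ∧ j = i then 1 else 0

lemma Core.count_more {i k : ℕ} {x y : V} {D : Finset V} (hx : x ∈ G.X i) (hy : y ∈ G.Y)
    (hD : y ∉ D) (hR : Ready G i k l C x)
    (h : Core G a l (heapUpd o x k D) (countUpd C i D) s) :
    Core G a l (heapUpd o x k (insert y D)) (countUpd C i (insert y D)) (s.traverse x y) ∧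
    (s.traverse x y).toDo = s.toDo.erase (x, y) := by
  have hk := hR.levelY y hy
  have hC : countUpd C i D y i = C y i := by simp [countUpd, hD]
  have := h.count hx hy (by rw [hk, hR.levelx]) (by rw [hk, hC]; exact hR.upper y hy)
    (by rw [hk, hC]; exact hR.lower y hy)
  refine ⟨this.1.congr (fun _ _ => rfl) (fun z hz j => ?_) (fun j z hz => ⟨rfl, ?_⟩), this.2⟩
  · rw [hC]
    split_ifs with hzj
    · obtain ⟨rfl, rfl⟩ := hzj; simp [countUpd]
    · simp only [countUpd, Finset.mem_insert]
      split_ifs <;> first | omega | tauto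
  · simp [heapUpd, hk]

/-- All arcs from `x` to the vertices of `Y` that are not in `D` wait for their traversals. -/
lemma Sure.traverse_all {i k : ℕ} {x u : V} {rest : List (V × V)} {Z : ℕ}
    (hx : x ∈ G.X i) (hu : u ∉ G.Y) (hR : Ready G i k l C x) (R : Finset V) :
    ∀ s tr, R ⊆ G.Y → s.toDo = R.image (fun y => (x, y)) →
    Core G a l (heapUpd o x k (G.Y \ R)) (countUpd C i (G.Y \ R)) s →
    (∀ s', s'.toDo = ∅ → Core G a l (heapUpd o x k G.Y) (countUpd C i G.Y) s' →
      Sure ⟨s', rest, some u, false, tr + R.card⟩ Z) →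
    Sure ⟨s, rest, some u, false, tr⟩ Z := by
  induction hn : R.card generalizing R with
  | zero =>
    intro s tr _ hs h hf
    obtain rfl := Finset.card_eq_zero.1 hn
    exact hf s (by simpa using hs) (by simpa using h)
  | succ n ih =>
    intro s tr hRY hs h hf
    have hne : R.Nonempty := Finset.card_pos.1 (by omega)
    refine .traverse (by rw [hs]; exact hne.image _) fun x' y hxy => ?_
    rw [hs, Finset.mem_image] at hxy
    obtain ⟨y', hyR, e⟩ := hxy
    obtain ⟨rfl, rfl⟩ := Prod.mk.inj e
    refine ⟨fun e => hu (e ▸ hRY hyR), ?_⟩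
    obtain ⟨h₁, h₂⟩ := h.count_more hx (hRY hyR) (by simp [hyR]) hR
    have hins : Insert.insert y' (G.Y \ R) = G.Y \ R.erase y' := by
      ext z
      simp only [Finset.mem_insert, Finset.mem_sdiff, Finset.mem_erase, not_and]
      by_cases hz : z = y'
      · subst hz; simp [hRY hyR]
      · simp [hz]
    rw [hins] at h₁
    refine ih (R.erase y') (by rw [Finset.card_erase_of_mem hyR, hn]; rfl) _ _
      ((Finset.erase_subset _ _).trans hRY) ?_ h₁ fun s' hs' hc => ?_
    · rw [h₂, hs]
      ext ⟨z₁, z₂⟩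
      simp only [Finset.mem_erase, Finset.mem_image, Prod.mk.injEq, ne_eq, not_and]
      constructor
      · rintro ⟨h1, z, hz, rfl, rfl⟩; exact ⟨z, ⟨h1 rfl, hz⟩, rfl, rfl⟩
      · rintro ⟨z, ⟨hzy, hz⟩, rfl, rfl⟩; exact ⟨fun _ => hzy, z, hz, rfl, rfl⟩
    · rw [Nat.add_assoc, Nat.add_comm 1]
      exact hf s' hs' hc

/-- Lifting `x ∈ X i`, whose heap holds all arcs to `Y`. -/
lemma Triple.lift_X {i j k q : ℕ} {x : V} (hx : x ∈ G.X i) (hj : j ≤ a) (hT : j ≤ T)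
    (hl : l x ≤ j + 1) (ho : o x = G.Y.image fun y => (y, q)) (hq : q ≤ j + 2)
    (hR : Ready G i k (Function.update l x (j + 2)) C x) :
    Triple (Core G a l o C) [(G.p j, x)] G.Y.card
      (Core G a (Function.update l x (j + 2)) (heapUpd o x k G.Y) (countUpd C i G.Y)) := by
  intro s src rest tr Z hs hA hB
  refine .insert_raise hs (fun e => G.p_X j hT i (e ▸ hx))
    (by rw [hA.levelX i x hx, hA.path j hj hT]; exact hl) ?_
  refine Sure.traverse_all (a := a) (o := o) hx (G.p_Y j hT) hR G.Y _ _ subset_rfl ?_ ?_ ?_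
  · have hp := hA.path j hj hT
    have hsx := hA.outX i x hx
    ext ⟨z₁, z₂⟩
    simp only [State.raise, Finset.mem_union, Finset.mem_image, Finset.mem_filter, hp, hsx, ho]
    simp
    grind
  · refine ((hA.toDo _).raise_X hj hT hx ?_).congr (fun _ _ => rfl) (fun y _ j => by
      simp [countUpd]) (fun _ z _ => ⟨rfl, by simp [heapUpd]⟩)
    intro e he
    rw [ho, Finset.mem_image] at he
    obtain ⟨_, _, rfl⟩ := he
    exact hq
  · intro s' hs' hc
    exact hB _ _ _ hs' hc (by omega)

lemma Triple.insert_XY {i k : ℕ} {x y : V} {D : Finset V} (hx : x ∈ G.X i) (hy : y ∈ G.Y)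
    (hD : y ∉ D) (hR : Ready G i k l C x) :
    Triple (Core G a l (heapUpd o x k D) (countUpd C i D)) [(x, y)] 1
      (Core G a l (heapUpd o x k (insert y D)) (countUpd C i (insert y D))) := by
  intro s src rest tr Z hs hA hB
  refine .insert hs (.traverse (by simp) fun x' y' hxy => ?_)
  simp only [Finset.mem_singleton, Prod.mk.injEq] at hxy
  obtain ⟨rfl, rfl⟩ := hxy
  obtain ⟨h₁, h₂⟩ := (hA.toDo {(x', y')}).count_more hx hy hD hR
  exact ⟨fun e => G.X_Y i x' hx (e ▸ hy), hB _ _ _ (by rw [h₂]; simp) h₁ le_rfl⟩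

/-- The first time that the arcs from `x ∈ X i` to `Y` are traversed. -/
lemma Triple.start_X {i k : ℕ} {x : V} (hx : x ∈ G.X i) (ho : o x = ∅) (hR : Ready G i k l C x) :
    Triple (Core G a l o C) (G.Y.toList.map fun y => (x, y)) G.Y.card
      (Core G a l (heapUpd o x k G.Y) (countUpd C i G.Y)) := by
  have := Triple.finset (A := fun D => Core G a l (heapUpd o x k D) (countUpd C i D))
    (f := fun y => [(x, y)]) (W := 1) G.Y
    (fun y hy E _ hE => Triple.insert_XY hx hy hE hR)
  rw [mul_one, ← List.map_eq_flatMap] at this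
  refine this.mono (fun s h => h.congr (fun _ _ => rfl) (fun _ _ _ => by simp [countUpd])
    fun i z _ => ⟨rfl, ?_⟩) (fun _ => id) le_rfl
  by_cases hz : z = x
  · subst hz; simp [heapUpd, ho]
  · simp [heapUpd, hz]

/-! ### Rounds: one pass over a group `X i` -/

/-- The level of a vertex of `X i` after `q` rounds of traversals. -/
def xLevel (i q : ℕ) : ℕ := 2 ^ (i + 1) * (q - 1) + 1

/-- The heap of a vertex of `X i` after `q` rounds of traversals. -/
def xHeap (G : Layout V T) (i q : ℕ) : Finset (V × ℕ) :=
  if q = 0 then ∅ else G.Y.image fun y => (y, 2 ^ (i + 1) * (q - 1) + 2 ^ i + 1)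

/-- All vertices of `Y` have level `h`, and `N i` rounds of traversals are done for `X i`. -/
def Std (G : Layout V T) (a h : ℕ) (N : ℕ → ℕ) : State V → Prop :=
  Core G a (fun v => if v ∈ G.Y then h else xLevel (G.rank v) (N (G.rank v)))
    (fun v => xHeap G (G.rank v) (N (G.rank v))) (fun _ i => 2 ^ (i + 1) * N i)

lemma Triple.raise_all_Y {j h : ℕ} {N : ℕ → ℕ} (hj : j ≤ a) (hT : j ≤ T) (hh : h ≤ j + 1) :
    Triple (Std G a h N) (G.Y.toList.map fun y => (G.p j, y)) 0 (Std G a (j + 2) N) := by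
  have := Triple.finset (W := 0) (f := fun y => [(G.p j, y)]) (A := fun D => Core G a
    (fun v => if v ∈ G.Y then (if v ∈ D then j + 2 else h) else xLevel (G.rank v) (N (G.rank v)))
    (fun v => xHeap G (G.rank v) (N (G.rank v))) (fun _ i => 2 ^ (i + 1) * N i)) G.Y ?_
  · rw [← List.map_eq_flatMap] at this
    refine this.mono (fun s hs => hs.congr ?_ ?_ ?_) (fun s hs => hs.congr ?_ ?_ ?_) (by simp)
    all_goals simp +contextual
  · intro y hy E hE hyE
    refine (Triple.raise_Y hj hT hy (by simp [hy, hyE, hh])).mono (fun _ => id)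
      (fun s hs => hs.congr (fun z hz => ?_) (fun _ _ _ => le_rfl) fun i x hx => ⟨?_, rfl⟩) le_rfl
    · by_cases hzy : z = y
      · subst hzy; simp [hz]
      · simp [hzy]
    · have : x ≠ y := fun e => G.X_Y i x hx (e ▸ hy)
      simp [this, G.X_Y i x hx]

/-- The arcs whose insertion leads to the traversals of all arcs from `x ∈ X i` to `Y`, when this
has been done `q` times. -/
noncomputable def roundArcs (G : Layout V T) (i q : ℕ) (x : V) : List (V × V) :=
  if q = 0 then G.Y.toList.map fun y => (x, y) else [(G.p (2 ^ (i + 1) * q - 1), x)]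

lemma Triple.round {i k : ℕ} {N : ℕ → ℕ} (hk : k = 2 ^ (i + 1) * N i + 2 ^ i + 1)
    (hj : 2 ^ (i + 1) * N i - 1 ≤ a) (hT : 2 ^ (i + 1) * N i - 1 ≤ T) :
    Triple (Std G a k N) ((G.X i).toList.flatMap (roundArcs G i (N i)))
      ((G.X i).card * G.Y.card) (Std G a k (Function.update N i (N i + 1))) := by
  have hpos : 0 < 2 ^ i := by positivity
  have hps : 2 ^ (i + 1) = 2 * 2 ^ i := by ring
  -- In mid-round, `E` is the set of processed vertices of `X i`, and each of them has added one
  -- count at scale `i` to every sink.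
  have := Triple.finset (W := G.Y.card) (f := roundArcs G i (N i)) (A := fun E => Core G a
    (fun v => if v ∈ G.Y then k else
      xLevel (G.rank v) (N (G.rank v) + if v ∈ E then 1 else 0))
    (fun v => xHeap G (G.rank v) (N (G.rank v) + if v ∈ E then 1 else 0))
    (fun _ i' => 2 ^ (i' + 1) * N i' + if i' = i then E.card else 0)) (G.X i) ?_
  · refine this.mono (fun s hs => hs.congr ?_ ?_ ?_) (fun s hs => hs.congr ?_ ?_ ?_) (by simp)
    · simp +contextual
    · simp +contextual
    · simp +contextual
    · simp +contextual
    · intro y _ i'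
      by_cases hi : i' = i
      · subst hi
        -- The round adds at most `2 ^ i` counts, but the bound is relaxed by `2 ^ (i + 1)`: it must
        -- keep pace with resets of `b_i(y)` to `k(y) - 2 ^ (i + 1)`.
        have := G.card_X i'
        simp only [if_true, Function.update_self, mul_add, mul_one]
        omega
      · simp [hi]
    · intro i' x hx
      by_cases hi : i' = i
      · subst hi
        simp [hx, G.X_Y _ x hx, G.rank_X _ x hx]
      · have : x ∉ G.X i := fun h => hi ((G.rank_X _ x hx).symm.trans (G.rank_X _ x h))
        simp [this, G.X_Y _ x hx, G.rank_X _ x hx, hi]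
  · intro x hx E hE hxE
    have hxY := G.X_Y i x hx
    have hrx := G.rank_X i x hx
    have hYx : ∀ y ∈ G.Y, y ≠ x := fun y hy e => hxY (e ▸ hy)
    have hcard : E.card + 1 ≤ 2 ^ i := by
      rw [← Finset.card_insert_of_notMem hxE]
      exact (Finset.card_le_card (Finset.insert_subset hx hE)).trans (G.card_X i)
    -- By truncated subtraction `xLevel i 0 = xLevel i 1 = 1`: the first round inserts the arcs to
    -- `Y` without lifting `x`.
    rcases Nat.eq_zero_or_pos (N i) with h0 | h0
    · rw [roundArcs, if_pos h0]
      refine (Triple.start_X (k := k) hx ?_ ⟨?_, ?_, ?_, ?_⟩).mono (fun _ => id)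
        (fun s hs => hs.congr ?_ ?_ ?_) le_rfl
      · simp [hrx, h0, hxE, xHeap]
      · simp +contextual
      · simp [hrx, h0, hxE, hxY, xLevel, hk]; omega
      · intro y hy; simp only [if_true]; omega
      · intro y hy; simp only [if_true]; omega
      · intro y hy; simp [hy]
      · intro y hy i'
        simp only [countUpd, hy, true_and, Finset.card_insert_of_notMem hxE]
        split_ifs <;> omega
      · intro i' z hz
        by_cases hzx : z = x
        · subst hzx
          simp [hrx, h0, hxE, hxY, xLevel, xHeap, heapUpd, hk]
        · simp [hzx, heapUpd]
    · rw [roundArcs, if_neg h0.ne']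
      obtain ⟨q, hq⟩ : ∃ q, N i = q + 1 := ⟨N i - 1, by omega⟩
      rw [hq, mul_add, mul_one] at hj hT
      rw [hq, mul_add, mul_one] at hk
      rw [hq, mul_add, mul_one]
      -- The priority is the level of `Y` in the previous round, `2 ^ i` above the old level of `x`;
      -- the new level is `2 ^ (i + 1)` above it.
      refine (Triple.lift_X (k := k) (q := 2 ^ (i + 1) * q + 2 ^ i + 1) hx hj hT ?_ ?_ ?_
        ⟨?_, ?_, ?_, ?_⟩).mono (fun _ => id) (fun s hs => hs.congr ?_ ?_ ?_) le_rfl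
      · simp only [hxY, hrx, hxE, hq, xLevel, if_false, Nat.add_sub_cancel, Nat.add_zero]
        omega
      · simp [hrx, hxE, xHeap, hq]
      · omega
      · intro y hy; simp [hYx y hy, hy]
      · simp only [Function.update_self]; omega
      · intro y hy; simp only [if_true, hq, mul_add, mul_one]; omega
      · intro y hy; simp only [if_true, hq, mul_add, mul_one]; omega
      · intro y hy; simp [hYx y hy, hy]
      · intro y hy i'
        simp only [countUpd, hy, true_and, Finset.card_insert_of_notMem hxE]
        split_ifs <;> omega
      · intro i' z hz
        by_cases hzx : z = x
        · subst hzx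
          simp only [Function.update_self, hrx, hxE, hxY, xLevel, xHeap, heapUpd, hq, hk,
            Finset.mem_insert, true_or, if_true, if_false, Nat.add_sub_cancel, mul_add, mul_one]
          simp; omega
        · simp [hzx, heapUpd]

/-! ### The schedule of rounds by 2-adic valuation -/

/-- The number of `t' ∈ {1, …, t}` with `padicValNat 2 t' = i`. -/
def rounds (t i : ℕ) : ℕ := (t + 2 ^ i) / 2 ^ (i + 1)

/-- Here `t + 1 = 2 ^ i * (2 * q + 1)`, with `q` the number of earlier rounds at scale `i`. Thus the
level `t + 2` of `Y` is exactly the one that `Triple.round` requires. -/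
lemma rounds_spec (t : ℕ) :
    t + 1 = 2 ^ (padicValNat 2 (t + 1) + 1) * rounds t (padicValNat 2 (t + 1)) +
      2 ^ padicValNat 2 (t + 1) := by
  set i := padicValNat 2 (t + 1) with hi
  obtain ⟨m, hm⟩ : 2 ^ i ∣ t + 1 := pow_padicValNat_dvd
  have hodd : ¬ 2 ∣ m := by
    rintro ⟨c, rfl⟩
    refine pow_succ_padicValNat_not_dvd (p := 2) (n := t + 1) (by omega) ⟨c, ?_⟩
    rw [← hi, hm]; ring
  obtain ⟨q, rfl⟩ : ∃ q, m = 2 * q + 1 := ⟨m / 2, by omega⟩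
  have hpos : 0 < 2 ^ i := by positivity
  have : rounds t i = q := by
    rw [rounds, Nat.div_eq_iff (by positivity)]
    have : 2 ^ i * (2 * q + 1) = q * 2 ^ (i + 1) + 2 ^ i := by ring
    have : 2 ^ (i + 1) = 2 * 2 ^ i := by ring
    omega
  rw [this, hm]; ring

/-- The quotient grows just when `2 ^ (i + 1)` divides `t + 1 + 2 ^ i`, that is, when `t + 1` is an
odd multiple of `2 ^ i`. -/
lemma rounds_succ (t : ℕ) :
    rounds (t + 1) = Function.update (rounds t) (padicValNat 2 (t + 1))
      (rounds t (padicValNat 2 (t + 1)) + 1) := by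
  ext i
  have hstep : rounds (t + 1) i = rounds t i + if 2 ^ (i + 1) ∣ t + 2 ^ i + 1 then 1 else 0 := by
    rw [rounds, rounds, show t + 1 + 2 ^ i = t + 2 ^ i + 1 by ring, Nat.succ_div]
  by_cases hi : i = padicValNat 2 (t + 1)
  · rw [hstep, hi, Function.update_self, if_pos]
    refine ⟨rounds t (padicValNat 2 (t + 1)) + 1, ?_⟩
    have := rounds_spec t
    generalize padicValNat 2 (t + 1) = j at *
    rw [mul_add, mul_one, pow_succ] at *
    omega
  · rw [hstep, Function.update_of_ne hi, if_neg, add_zero]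
    rintro ⟨c, hc⟩
    have hpos : 0 < 2 ^ i := by positivity
    obtain ⟨d, rfl⟩ : ∃ d, c = d + 1 := by
      cases c with
      | zero => simp at hc
      | succ d => exact ⟨d, rfl⟩
    have ht : t + 1 = 2 ^ i * (2 * d + 1) := by
      have : 2 ^ (i + 1) * (d + 1) = 2 ^ i * (2 * d + 1) + 2 ^ i := by ring
      omega
    apply hi
    rw [ht, padicValNat.mul (by positivity) (by omega), padicValNat.prime_pow,
      padicValNat.eq_zero_of_not_dvd (by omega), add_zero]

/-- The arcs that are inserted while the level of the vertices of `Y` is `t + 1` or `t + 2`. -/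
noncomputable def blockArcs (G : Layout V T) (t : ℕ) : List (V × V) :=
  (G.Y.toList.map fun y => (G.p t, y)) ++ ([(G.p t, G.p (t + 1))] ++
    (G.X (padicValNat 2 (t + 1))).toList.flatMap
      (roundArcs G (padicValNat 2 (t + 1)) (rounds t (padicValNat 2 (t + 1)))))

lemma Triple.block {t : ℕ} (ht : t < T) :
    Triple (Std G t (t + 1) (rounds t)) (blockArcs G t)
      ((G.X (padicValNat 2 (t + 1))).card * G.Y.card)
      (Std G (t + 1) (t + 2) (rounds (t + 1))) := by
  have h := rounds_spec t
  rw [rounds_succ]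
  have hpos : 0 < 2 ^ padicValNat 2 (t + 1) := by positivity
  refine ((Triple.raise_all_Y le_rfl ht.le le_rfl).append
    ((Triple.raise_p (a := t) ht).append (Triple.round ?_ ?_ ?_))).mono (fun _ => id)
    (fun _ => id) (by omega)
  all_goals omega

/-- The whole sequence of insertions. -/
noncomputable def allArcs (G : Layout V T) : List (V × V) :=
  (List.range T).flatMap (blockArcs G)

lemma sure_allArcs (G : Layout V T) :
    Sure (Config.init (allArcs G))
      (∑ t ∈ Finset.range T, (G.X (padicValNat 2 (t + 1))).card * G.Y.card) := by
  have h := Triple.range (A := fun t => Std G t (t + 1) (rounds t)) (n := T)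
    (f := blockArcs G) (W := fun t => (G.X (padicValNat 2 (t + 1))).card * G.Y.card)
    fun t ht => Triple.block ht
  have h₀ : ∀ i, rounds 0 i = 0 := fun i => by
    rw [rounds, zero_add]
    exact Nat.div_eq_of_lt (Nat.pow_lt_pow_right (by norm_num) (by omega))
  have := h (State.init V) none [] 0 _ rfl ?_ fun s' src' tr' hs' _ htr =>
    Sure.of_halted (Z := ∑ t ∈ Finset.range T, (G.X (padicValNat 2 (t + 1))).card * G.Y.card)
      hs' (by simpa using htr)
  · rw [List.append_nil] at this
    exact this
  · refine ⟨fun j hj _ => ?_, ?_, ?_, ?_, ?_, ?_, ?_⟩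
    · obtain rfl : j = 0 := by omega
      rfl
    all_goals simp +contextual [State.init, h₀, xLevel, xHeap]

/-! ### The arcs are distinct and loop-free -/

omit [DecidableEq V] in
lemma roundArcs_mem {i q : ℕ} {x : V} {e : V × V} :
    e ∈ roundArcs G i q x ↔ (q = 0 ∧ e.1 = x ∧ e.2 ∈ G.Y) ∨
      (q ≠ 0 ∧ e = (G.p (2 ^ (i + 1) * q - 1), x)) := by
  unfold roundArcs
  split_ifs with h
  · simp [h, Prod.ext_iff]; grind
  · simp [h]

omit [DecidableEq V] in
lemma roundArcs_nodup {i q : ℕ} {x : V} : (roundArcs G i q x).Nodup := by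
  unfold roundArcs
  split_ifs
  · exact G.Y.nodup_toList.map fun _ _ h => (Prod.mk.inj h).2
  · simp

-- In each case the arc alone determines `t`: from the index of its tail on the path, from the group
-- of its tail, or from `j` and the group of its head. This is what makes different blocks disjoint.
omit [DecidableEq V] in
lemma blockArcs_mem {t : ℕ} {e : V × V} (he : e ∈ blockArcs G t) :
    (e.1 = G.p t ∧ (e.2 ∈ G.Y ∨ e.2 = G.p (t + 1))) ∨
      (∃ i, t + 1 = 2 ^ i ∧ e.1 ∈ G.X i ∧ e.2 ∈ G.Y) ∨
      ∃ i j, j ≤ t ∧ t = j + 2 ^ i ∧ e.1 = G.p j ∧ e.2 ∈ G.X i := by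
  simp only [blockArcs, List.mem_append, List.mem_map, Finset.mem_toList, List.mem_singleton,
    List.mem_flatMap, roundArcs_mem] at he
  rcases he with ⟨y, hy, rfl⟩ | rfl | ⟨x, hx, h⟩
  · exact .inl ⟨rfl, .inl hy⟩
  · exact .inl ⟨rfl, .inr rfl⟩
  · have hspec := rounds_spec t
    rcases h with ⟨h₀, rfl, hy⟩ | ⟨h₀, rfl⟩
    · rw [h₀, mul_zero, zero_add] at hspec
      exact .inr (.inl ⟨_, hspec, hx, hy⟩)
    · have : 0 < 2 ^ (padicValNat 2 (t + 1) + 1) * rounds t (padicValNat 2 (t + 1)) := by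
        positivity
      have : 0 < 2 ^ padicValNat 2 (t + 1) := by positivity
      exact .inr (.inr ⟨_, _, by omega, by omega, rfl, hx⟩)

omit [DecidableEq V] in
lemma blockArcs_ne {t : ℕ} (ht : t < T) {e : V × V} (he : e ∈ blockArcs G t) : e.1 ≠ e.2 := by
  intro h
  rcases blockArcs_mem he with ⟨h₁, h₂ | h₂⟩ | ⟨i, hq, h₁, h₂⟩ | ⟨i, j, hj, hq, h₁, h₂⟩
  · exact G.p_Y t ht.le (h₁ ▸ h ▸ h₂)
  · have := G.p_inj t ht.le (t + 1) ht (by rw [← h₁, ← h₂, h]); omega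
  · exact G.X_Y _ _ h₁ (h ▸ h₂)
  · exact G.p_X j (by omega) _ (h₁ ▸ h ▸ h₂)

omit [DecidableEq V] in
lemma blockArcs_disjoint {t t' : ℕ} (ht : t < T) (ht' : t' < T) {e : V × V}
    (he : e ∈ blockArcs G t) (he' : e ∈ blockArcs G t') : t = t' := by
  rcases blockArcs_mem he with ⟨h₁, h₂⟩ | ⟨i, hq, h₁, h₂⟩ | ⟨i, j, hj, hq, h₁, h₂⟩ <;>
  rcases blockArcs_mem he' with ⟨g₁, g₂⟩ | ⟨i', hq', g₁, g₂⟩ | ⟨i', j', hj', hq', g₁, g₂⟩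
  · exact G.p_inj t ht.le t' ht'.le (h₁.symm.trans g₁)
  · exact absurd (h₁ ▸ g₁) (G.p_X t ht.le _)
  · rcases h₂ with h₂ | h₂
    · exact absurd h₂ (G.X_Y _ _ g₂)
    · exact absurd (h₂ ▸ g₂) (G.p_X _ ht _)
  · exact absurd (g₁ ▸ h₁) (G.p_X t' ht'.le _)
  · obtain rfl : i = i' := (G.rank_X _ _ h₁).symm.trans (G.rank_X _ _ g₁)
    omega
  · exact absurd (g₁ ▸ h₁) (G.p_X j' (by omega) _)
  · rcases g₂ with g₂ | g₂
    · exact absurd g₂ (G.X_Y _ _ h₂)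
    · exact absurd (g₂ ▸ h₂) (G.p_X _ ht' _)
  · exact absurd (h₁ ▸ g₁) (G.p_X j (by omega) _)
  · obtain rfl : i = i' := (G.rank_X _ _ h₂).symm.trans (G.rank_X _ _ g₂)
    have := G.p_inj j (by omega) j' (by omega) (h₁.symm.trans g₁)
    omega

omit [DecidableEq V] in
lemma blockArcs_nodup {t : ℕ} (ht : t < T) : (blockArcs G t).Nodup := by
  have hspec := rounds_spec t
  have hpos : 0 < 2 ^ padicValNat 2 (t + 1) := by positivity
  rw [blockArcs, List.nodup_append', List.nodup_append']
  refine ⟨G.Y.nodup_toList.map fun _ _ h => (Prod.mk.inj h).2, ⟨by simp, ?_, ?_⟩, ?_⟩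
  · rw [List.nodup_flatMap]
    refine ⟨fun _ _ => roundArcs_nodup, (Finset.nodup_toList _).imp_of_mem ?_⟩
    intro x x' hx hx' hne e he he'
    rw [Finset.mem_toList] at hx hx'
    rw [roundArcs_mem] at he he'
    rcases he with ⟨_, h, _⟩ | ⟨_, h⟩ <;> rcases he' with ⟨_, h', _⟩ | ⟨_, h'⟩
    · exact hne (h.symm.trans h')
    · contradiction
    · contradiction
    · exact hne (Prod.mk.inj (h.symm.trans h')).2
  · intro e he he'
    rw [List.mem_singleton] at he
    subst he
    simp only [List.mem_flatMap, Finset.mem_toList, roundArcs_mem, Prod.mk.injEq] at he'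
    obtain ⟨x, hx, ⟨-, h, -⟩ | ⟨-, -, h⟩⟩ := he'
    · exact G.p_X t ht.le _ (h ▸ hx)
    · exact G.p_X (t + 1) ht _ (h ▸ hx)
  · intro e he he'
    simp only [List.mem_map, Finset.mem_toList] at he
    obtain ⟨y, hy, rfl⟩ := he
    simp only [List.mem_append, List.mem_singleton, List.mem_flatMap, Finset.mem_toList,
      roundArcs_mem, Prod.mk.injEq, true_and] at he'
    obtain h | ⟨x, hx, ⟨-, h, -⟩ | ⟨-, -, h⟩⟩ := he'
    · exact G.p_Y (t + 1) ht (h ▸ hy)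
    · exact G.p_X t ht.le _ (h ▸ hx)
    · exact G.X_Y _ x hx (h ▸ hy)

omit [DecidableEq V] in
lemma allArcs_nodup : (allArcs G).Nodup := by
  rw [allArcs, List.nodup_flatMap]
  refine ⟨fun t ht => blockArcs_nodup (List.mem_range.1 ht), List.nodup_range.imp_of_mem ?_⟩
  intro t t' ht ht' hne e he he'
  exact hne (blockArcs_disjoint (List.mem_range.1 ht) (List.mem_range.1 ht') he he')

omit [DecidableEq V] in
lemma allArcs_ne {e : V × V} (he : e ∈ allArcs G) : e.1 ≠ e.2 := by
  rw [allArcs, List.mem_flatMap] at he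
  obtain ⟨t, ht, he⟩ := he
  exact blockArcs_ne (List.mem_range.1 ht) he

-- The arcs from the path to `Y` suffice, since each block contains one per sink.
omit [DecidableEq V] in
lemma le_length_allArcs : T * G.Y.card ≤ (allArcs G).length := by
  have h : ∀ n, n * G.Y.card ≤ ((List.range n).flatMap (blockArcs G)).length := by
    intro n
    induction n with
    | zero => simp
    | succ n ih =>
      rw [List.range_succ, List.flatMap_append, List.length_append, Nat.succ_mul]
      refine Nat.add_le_add ih ?_
      simp [blockArcs]
  exact h T

/-! ### Counting traversals on a concrete layout -/

/-- Odd numbers contribute `1` each, and halving the even ones gives twice the sum for the previous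
`L`. -/
lemma sum_pow_padicValNat (L : ℕ) :
    2 * ∑ t ∈ Finset.range (2 ^ L), 2 ^ padicValNat 2 (t + 1) = (L + 2) * 2 ^ L := by
  have hsplit : ∀ (f : ℕ → ℕ) n, ∑ t ∈ Finset.range (2 * n), f t =
      ∑ t ∈ Finset.range n, (f (2 * t) + f (2 * t + 1)) := by
    intro f n
    induction n with
    | zero => simp
    | succ n ih =>
      rw [Nat.mul_succ, Finset.sum_range_succ, Finset.sum_range_succ, Finset.sum_range_succ, ih]
      ring
  induction L with
  | zero => simp
  | succ L ih =>
    have h₁ : ∀ t, padicValNat 2 (2 * t + 1) = 0 := fun t =>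
      padicValNat.eq_zero_of_not_dvd (by omega)
    have h₂ : ∀ t, padicValNat 2 (2 * t + 1 + 1) = padicValNat 2 (t + 1) + 1 := fun t => by
      rw [show 2 * t + 1 + 1 = 2 * (t + 1) by ring, padicValNat.mul (by norm_num) (by omega),
        padicValNat.self (by norm_num), add_comm]
    rw [pow_succ' 2 L, hsplit]
    simp only [h₁, h₂, Finset.sum_add_distrib, pow_succ, ← Finset.sum_mul]
    simp
    linarith

/-- The layout on `Fin n`. -/
def finLayout (L n : ℕ) (hn : 4 * 2 ^ L ≤ n) : Layout (Fin n) (2 ^ L) where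
  -- Reduction modulo `n` only makes `p` total; the indices in use are at most `2 ^ L < n`.
  p j := ⟨j % n, Nat.mod_lt _ (by have : 0 < 2 ^ L := by positivity
                                  omega)⟩
  -- Dyadic intervals fill the gap between the path and `Y`; the condition `i ≤ L` keeps them below
  -- `3 * 2 ^ L`.
  X i := {v | 2 ^ L + 2 ^ i ≤ v.val ∧ v.val < 2 ^ L + 2 ^ (i + 1) ∧ i ≤ L}
  Y := {v | 3 * 2 ^ L ≤ v.val ∧ v.val < 4 * 2 ^ L}
  rank v := Nat.log 2 (v.val - 2 ^ L)
  p_inj j hj j' hj' h := by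
    have : 0 < 2 ^ L := by positivity
    rw [Fin.mk.injEq, Nat.mod_eq_of_lt (by omega), Nat.mod_eq_of_lt (by omega)] at h
    exact h
  p_X j hj i := by
    have : 0 < 2 ^ L := by positivity
    have : 0 < 2 ^ i := by positivity
    simp only [Finset.mem_filter, Finset.mem_univ, true_and]
    rw [Nat.mod_eq_of_lt (by omega)]
    omega
  p_Y j hj := by
    have : 0 < 2 ^ L := by positivity
    simp only [Finset.mem_filter, Finset.mem_univ, true_and]
    rw [Nat.mod_eq_of_lt (by omega)]
    omega
  X_Y i x := by
    simp only [Finset.mem_filter, Finset.mem_univ, true_and]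
    rintro ⟨-, h₁, h₂⟩ ⟨h₃, -⟩
    have : 2 ^ (i + 1) ≤ 2 ^ (L + 1) := Nat.pow_le_pow_right (by norm_num) (by omega)
    rw [pow_succ 2 L] at this
    omega
  rank_X i x := by
    simp only [Finset.mem_filter, Finset.mem_univ, true_and]
    rintro ⟨h₁, h₂, -⟩
    exact Nat.log_eq_of_pow_le_of_lt_pow (by omega) (by omega)
  card_X i := by
    have h : (({v : Fin n | 2 ^ L + 2 ^ i ≤ v.val ∧ v.val < 2 ^ L + 2 ^ (i + 1) ∧ i ≤ L} :
        Finset (Fin n)).map Fin.valEmbedding) ⊆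
        Finset.Ico (2 ^ L + 2 ^ i) (2 ^ L + 2 ^ (i + 1)) := by
      intro z; simp; grind
    have := Finset.card_le_card h
    have hp : 2 ^ (i + 1) = 2 * 2 ^ i := by ring
    rw [Finset.card_map, Nat.card_Ico] at this
    omega

lemma card_finLayout_Y (L n : ℕ) (hn : 4 * 2 ^ L ≤ n) : (finLayout L n hn).Y.card = 2 ^ L := by
  have h : (finLayout L n hn).Y.map Fin.valEmbedding = Finset.Ico (3 * 2 ^ L) (4 * 2 ^ L) := by
    ext z
    simp only [finLayout, Finset.mem_map, Finset.mem_filter, Finset.mem_univ, true_and,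
      Fin.valEmbedding_apply, Finset.mem_Ico]
    exact ⟨fun ⟨v, hv, e⟩ => e ▸ hv, fun hz => ⟨⟨z, by omega⟩, hz, rfl⟩⟩
  rw [← Finset.card_map, h, Nat.card_Ico]
  omega

lemma card_finLayout_X (L n : ℕ) (hn : 4 * 2 ^ L ≤ n) {i : ℕ} (hi : i ≤ L) :
    ((finLayout L n hn).X i).card = 2 ^ i := by
  have hp : 2 ^ (i + 1) ≤ 2 ^ (L + 1) := Nat.pow_le_pow_right (by norm_num) (by omega)
  rw [pow_succ 2 L] at hp
  have h : ((finLayout L n hn).X i).map Fin.valEmbedding =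
      Finset.Ico (2 ^ L + 2 ^ i) (2 ^ L + 2 ^ (i + 1)) := by
    ext z
    simp only [finLayout, Finset.mem_map, Finset.mem_filter, Finset.mem_univ, true_and,
      Fin.valEmbedding_apply, Finset.mem_Ico]
    exact ⟨fun ⟨v, hv, e⟩ => e ▸ ⟨hv.1, hv.2.1⟩,
      fun hz => ⟨⟨z, by omega⟩, ⟨hz.1, hz.2, hi⟩, rfl⟩⟩
  rw [← Finset.card_map, h, Nat.card_Ico, pow_succ]
  omega

lemma sum_card_finLayout (L n : ℕ) (hn : 4 * 2 ^ L ≤ n) :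
    2 * ∑ t ∈ Finset.range (2 ^ L), ((finLayout L n hn).X (padicValNat 2 (t + 1))).card *
      (finLayout L n hn).Y.card = (L + 2) * 2 ^ L * 2 ^ L := by
  rw [← Finset.sum_mul, card_finLayout_Y, ← mul_assoc, ← sum_pow_padicValNat]
  congr 2
  refine Finset.sum_congr rfl fun t ht => card_finLayout_X L n hn ?_
  have h₁ : 2 ^ padicValNat 2 (t + 1) ≤ t + 1 := Nat.le_of_dvd (by omega) pow_padicValNat_dvd
  have h₂ := Finset.mem_range.1 ht
  exact (Nat.pow_le_pow_iff_right (by norm_num)).1 (h₁.trans h₂)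

end DenseAlgorithm

theorem mainTheorem6 :
    ∃ a b c : ℝ, 0 < a ∧ 0 < b ∧ 0 < c ∧ ∃ N : ℕ, ∀ n : ℕ, N ≤ n →
      ∃ arcs : List (Fin n × Fin n),
        arcs.Nodup ∧ (∀ e ∈ arcs, e.1 ≠ e.2) ∧
        a * (n : ℝ) ^ 2 ≤ (arcs.length : ℝ) ∧ (arcs.length : ℝ) ≤ b * (n : ℝ) ^ 2 ∧
        (∃ o : DenseAlgorithm.Config (Fin n), DenseAlgorithm.IsOutcome arcs o) ∧
        ∀ o : DenseAlgorithm.Config (Fin n), DenseAlgorithm.IsOutcome arcs o →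
          o.cycle = false ∧ c * ((n : ℝ) ^ 2 * Real.log n) ≤ (o.traversals : ℝ) := by
  -- From `n < 8 * 2 ^ L` follows `n ^ 2 ≤ 64 * 4 ^ L`, and there are at least `4 ^ L` arcs.
  -- Distinct pairs number at most `n ^ 2`. With `log n ≤ 2 * (L + 2)` and at least `(L + 2) * 4 ^ L
  -- / 2` traversals, `c = 1 / (64 * 2 * 2)` works. `n ≥ 4` allows `L = Nat.log 2 n - 2`.
  refine ⟨1 / 64, 1, 1 / 256, by norm_num, by norm_num, by norm_num, 4, fun n hn => ?_⟩
  obtain ⟨L, hL⟩ : ∃ L, Nat.log 2 n = L + 2 := by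
    have : 2 ≤ Nat.log 2 n := Nat.le_log_of_pow_le (by norm_num) (by omega)
    exact ⟨Nat.log 2 n - 2, by omega⟩
  have h₁ : 4 * 2 ^ L ≤ n := by
    have := Nat.pow_log_le_self 2 (x := n) (by omega)
    rw [hL, pow_add] at this; omega
  have h₂ : n < 8 * 2 ^ L := by
    have := Nat.lt_pow_succ_log_self (b := 2) (by norm_num) n
    rw [hL, Nat.succ_eq_add_one, add_assoc, pow_add] at this; omega
  have hT : (n : ℝ) ≤ 8 * 2 ^ L := by exact_mod_cast h₂.le
  have hsq : (n : ℝ) ^ 2 ≤ 64 * (2 ^ L * 2 ^ L) := by nlinarith [(Nat.cast_nonneg n : (0:ℝ) ≤ n)]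
  set G := DenseAlgorithm.finLayout L n h₁
  obtain ⟨hex, hall⟩ := DenseAlgorithm.sure_allArcs G
  refine ⟨DenseAlgorithm.allArcs G, DenseAlgorithm.allArcs_nodup,
    fun e => DenseAlgorithm.allArcs_ne, ?_, ?_, hex, fun o ho => ?_⟩
  · have := DenseAlgorithm.le_length_allArcs (G := G)
    rw [DenseAlgorithm.card_finLayout_Y] at this
    have : (2 ^ L * 2 ^ L : ℝ) ≤ (DenseAlgorithm.allArcs G).length := by exact_mod_cast this
    linarith
  · have := (DenseAlgorithm.allArcs_nodup (G := G)).length_le_card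
    rw [Fintype.card_prod, Fintype.card_fin, ← sq] at this
    rw [one_mul]
    exact_mod_cast this
  · obtain ⟨hc, htr⟩ := hall o ho.1 ho.2
    refine ⟨hc, ?_⟩
    have hW : (L + 2) * 2 ^ L * 2 ^ L ≤ 2 * o.traversals := by
      rw [← DenseAlgorithm.sum_card_finLayout L n h₁]
      exact Nat.mul_le_mul_left 2 htr
    have hW' : ((L + 2) * 2 ^ L * 2 ^ L : ℝ) ≤ 2 * o.traversals := by exact_mod_cast hW
    have hlog : Real.log n ≤ L + 3 := by
      have hn0 : (0 : ℝ) < n := by exact_mod_cast (by omega : 0 < n)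
      calc Real.log n ≤ Real.log (2 ^ (L + 3)) := by
            refine Real.log_le_log hn0 (hT.trans (le_of_eq ?_))
            ring
        _ = (L + 3) * Real.log 2 := by rw [Real.log_pow]; push_cast; ring
        _ ≤ (L + 3) * 1 := by
            gcongr
            linarith [Real.log_two_lt_d9]
        _ = L + 3 := mul_one _
    have hlog' : Real.log n ≤ 2 * (L + 2) := by
      have : (0 : ℝ) ≤ L := Nat.cast_nonneg L
      linarith
    have := mul_le_mul hsq hlog' (Real.log_natCast_nonneg n) (by positivity)
    nlinarith
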